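/- Let $\mathbb{T}=\mathbb{R}/\mathbb{Z}$, identified with the unit circle via $x\mapsto\zeta=e^{2\pi i x}$, and let $m$ be the normalized Lebesgue measure on $\mathbb{T}$. For a complex (finite) Borel measure $\mu$ on $\mathbb{T}$ write $\widehat{\mu}(n)=\int_{\mathbb{T}}\zeta^{-n}\,d\mu(\zeta)$; we say that $\mu$ is supported on a compact set $K$ if $\mu(E)=0$ for every Borel set $E\subset\mathbb{T}\setminus K$. Let $(w_n)_{n\ge 0}$ be a decreasing (i.e. non-increasing) sequence of real numbers with $w_n\to 0$. Then for every $\varepsilon>0$ there exists a compact set $K\subset\mathbb{T}$ with $m(K)>1-\varepsilon$ such that every complex Borel measure $\mu$ supported on $K$ with $$\sup_{n\ge 0}\frac{|\widehat{\mu}(n)|}{w_n}<\infty$$ is zero. (If some $w_n=0$, the quotient is read with $0/0=0$ and $c/0=\infty$ for $c>0$; that is, the condition means that there is $C<\infty$ with $|\widehat{\mu}(n)|\le C\,w_n$ for all $n\ge 0$.) -/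

import Mathlib

/-- The `n`-th Fourier coefficient `∫ ζ⁻ⁿ dμ(ζ)` of a complex Borel measure on the circle
`𝕋 = ℝ/ℤ`, with `ζ = exp (2πi x)`; here `fourier (-n) x = exp (-2πi n x)`. -/
noncomputable def complexMeasureFourierCoeff
    (μ : MeasureTheory.ComplexMeasure UnitAddCircle) (n : ℤ) : ℂ :=
  MeasureTheory.VectorMeasure.integral μ (fun x : UnitAddCircle => (fourier (-n) x : ℂ))
    (ContinuousLinearMap.mul ℝ ℂ)

/-- The complex measure `μ` is supported on `K`: every measurable set that misses `K` is `μ`-null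
(equivalently, the total variation of `μ` vanishes off `K`). -/
def ComplexMeasureSupportedOn
    (μ : MeasureTheory.ComplexMeasure UnitAddCircle) (K : Set UnitAddCircle) : Prop :=
  ∀ E : Set UnitAddCircle, MeasurableSet E → Disjoint E K → μ E = 0

/-- A complex measure has finite total variation. -/
theorem isFiniteMeasure_variation_complexMeasure {α : Type*} [MeasurableSpace α]
    (μ : MeasureTheory.ComplexMeasure α) :
    MeasureTheory.IsFiniteMeasure μ.variation := by
  have h : μ.variation ≤ (MeasureTheory.ComplexMeasure.re μ).totalVariation
      + (MeasureTheory.ComplexMeasure.im μ).totalVariation := by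
    apply MeasureTheory.VectorMeasure.variation_le_of_forall_enorm_le
    intro E _
    have h1 := (MeasureTheory.ComplexMeasure.re μ).enorm_le_totalVariation E
    have h2 := (MeasureTheory.ComplexMeasure.im μ).enorm_le_totalVariation E
    refine le_trans ?_ (add_le_add h1 h2)
    change ‖μ E‖ₑ ≤ ‖(μ E).re‖ₑ + ‖(μ E).im‖ₑ
    have h3 : ‖μ E‖₊ ≤ ‖(μ E).re‖₊ + ‖(μ E).im‖₊ := by
      have := Complex.norm_le_abs_re_add_abs_im (μ E)
      exact_mod_cast this
    simp only [enorm_eq_nnnorm]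
    exact_mod_cast h3
  exact MeasureTheory.isFiniteMeasure_of_le _ h

/-- The characters are integrable against every complex measure, so that the integral defining
`complexMeasureFourierCoeff` is never a default value. -/
theorem integrable_fourier_complexMeasure
    (μ : MeasureTheory.ComplexMeasure UnitAddCircle) (n : ℤ) :
    MeasureTheory.VectorMeasure.Integrable μ
      (fun x : UnitAddCircle => (fourier (-n) x : ℂ)) := by
  have := isFiniteMeasure_variation_complexMeasure μ
  exact (ContinuousMap.continuous (fourier (-n))).integrable_of_hasCompactSupport
    (HasCompactSupport.of_compactSpace _)

open MeasureTheory Filter Topology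

/-! An analytic polynomial `p` with `p(0) = 0` can be close to 1 on the circle off a set of small
measure (`exists_polynomial_near_one_in_measure`). Replacing `ζ` by `ζ⁻ᴺ` keeps the measure of the
bad set and pushes all frequencies far out. If `μ` lives where `p(ζ⁻ᴺ) ≈ 1`, then `μ̂(l) ≈ ∑_{k≥1}
a_k μ̂(l + kN)`, and for large `N` this is small because `w → 0`: one-sided decay controls
coefficients of either sign (`norm_complexMeasureFourierCoeff_le`). Intersecting such sets with
summable errors gives `K`, on which every `μ̂(l)` must vanish. -/

/-! ### Analytic polynomials close to 1 in measure. -/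

theorem exists_polynomial_approx_of_differentiableOn {f : ℂ → ℂ} {R : ℝ} (hR : 1 < R)
    (hf : DifferentiableOn ℂ f (Metric.closedBall 0 R)) {δ : ℝ} (hδ : 0 < δ) :
    ∃ (a : ℕ → ℂ) (n : ℕ), a 0 = f 0 ∧
      ∀ z : ℂ, ‖z‖ ≤ 1 → ‖∑ k ∈ Finset.range n, a k * z ^ k - f z‖ < δ := by
  lift R to NNReal using by linarith
  obtain ⟨s, hs1, hsR⟩ := exists_between hR
  lift s to NNReal using by linarith
  have hp := hf.hasFPowerSeriesOnBall (by exact_mod_cast (zero_lt_one.trans hR))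
  have hu := hp.tendstoUniformlyOn (r' := s) (by exact_mod_cast hsR)
  rw [Metric.tendstoUniformlyOn_iff] at hu
  obtain ⟨n, hn⟩ := (hu δ hδ).exists
  refine ⟨(cauchyPowerSeries f 0 R).coeff, n, hp.coeff_zero _, fun z hz => ?_⟩
  have := hn z (by simpa using hz.trans_lt hs1)
  rw [dist_comm, dist_eq_norm, zero_add, FormalMultilinearSeries.partialSum] at this
  simpa only [FormalMultilinearSeries.apply_eq_pow_smul_coeff, smul_eq_mul, mul_comm] using this

/-- On the circle `1 + 2z/(1-z) = (1+z)/(1-z)` is purely imaginary, so the exponent has real part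
`-M`. -/
theorem norm_exp_mul_two_mul_div_one_sub {z : ℂ} (hz : ‖z‖ = 1) (hz1 : z ≠ 1) (M : ℝ) :
    ‖Complex.exp (M * (2 * z / (1 - z)))‖ = Real.exp (-M) := by
  have h1 : (1 : ℂ) - z ≠ 0 := sub_ne_zero.2 hz1.symm
  have h2 : Complex.normSq z = 1 := by rw [Complex.normSq_eq_norm_sq, hz, one_pow]
  have h3 : Complex.normSq (1 - z) ≠ 0 := by simpa using h1
  rw [Complex.norm_exp, Complex.re_ofReal_mul]
  have h4 : (2 * z / (1 - z)).re = -1 := by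
    rw [Complex.div_re]
    rw [Complex.normSq_apply] at h2
    field_simp
    rw [Complex.normSq_apply]
    simp
    nlinarith
  rw [h4, mul_neg_one]

theorem ae_ne_zero_haarAddCircle :
    ∀ᵐ x ∂(AddCircle.haarAddCircle : Measure UnitAddCircle), x ≠ 0 := by
  have : Nontrivial Circle := ⟨1, Circle.exp Real.pi, fun h => by
    have := congrArg Complex.re (congrArg (fun z : Circle => (z : ℂ)) h)
    norm_num [Circle.coe_exp] at this⟩
  have : Nontrivial UnitAddCircle :=
    (AddCircle.homeomorphCircle (one_ne_zero (α := ℝ))).surjective.nontrivial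
  have := ConnectedSpace.neBot_nhdsWithin_compl_of_nontrivial_of_t1space (0 : UnitAddCircle)
  simp [ae_iff]

/-- The model is `g = 1 - exp(2Mz/(1-z))`: it vanishes at 0, yet `|g - 1| = e^{-M}` on the circle
minus the point 1. Its dilates `g(rz)`, `r < 1`, converge to it a.e., hence in measure, and are
uniform limits of Taylor polynomials. -/
theorem exists_polynomial_near_one_in_measure {η : ℝ} (hη : 0 < η) :
    ∃ (a : ℕ → ℂ) (n : ℕ), a 0 = 0 ∧
      (AddCircle.haarAddCircle : Measure UnitAddCircle).real
        {x | η ≤ ‖∑ k ∈ Finset.range n, a k * (x.toCircle : ℂ) ^ k - 1‖} < η := by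
  obtain ⟨M, hM⟩ : ∃ M : ℝ, Real.exp (-M) < η / 3 :=
    (Real.tendsto_exp_neg_atTop_nhds_zero.eventually_lt_const (by positivity)).exists
  let r : ℕ → ℝ := fun k => 1 - 1 / ((k : ℝ) + 1)
  have hr : Tendsto r atTop (𝓝 1) := by
    simpa only [sub_zero] using (tendsto_const_nhds (x := (1 : ℝ))).sub
      (tendsto_one_div_add_atTop_nhds_zero_nat (𝕜 := ℝ))
  have hr1 (k) : r k < 1 := by have : 0 < 1 / ((k : ℝ) + 1) := by positivity
                               simp only [r]; linarith
  have hr0 (k) : 0 ≤ r k := by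
    have : 1 / ((k : ℝ) + 1) ≤ 1 := by
      rw [div_le_one (by positivity)]; linarith [Nat.cast_nonneg (α := ℝ) k]
    simp only [r]; linarith
  let g : ℂ → ℂ := fun z => 1 - Complex.exp (M * (2 * z / (1 - z)))
  let f : ℕ → UnitAddCircle → ℂ := fun k x => g (r k * x.toCircle)
  have hne (k : ℕ) {z : ℂ} (hz : r k * ‖z‖ < 1) : 1 - (r k : ℂ) * z ≠ 0 := by
    intro h
    have h2 : ‖(r k : ℂ) * z‖ = 1 := by rw [← sub_eq_zero.1 h, norm_one]
    rw [norm_mul, Complex.norm_real, Real.norm_of_nonneg (hr0 k)] at h2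
    linarith
  have hcont (k) : Continuous (f k) := by
    have : ∀ x : UnitAddCircle, 1 - (r k : ℂ) * x.toCircle ≠ 0 := fun x =>
      hne k (by rw [Circle.norm_coe, mul_one]; exact hr1 k)
    have hc : Continuous fun x : UnitAddCircle => (x.toCircle : ℂ) :=
      continuous_subtype_val.comp AddCircle.continuous_toCircle
    simp only [f, g]
    fun_prop (disch := assumption)
  have hlim : ∀ᵐ x ∂(AddCircle.haarAddCircle : Measure UnitAddCircle),
      Tendsto (fun k => f k x) atTop (𝓝 (g x.toCircle)) := by
    filter_upwards [ae_ne_zero_haarAddCircle] with x hx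
    have hx1 : (x.toCircle : ℂ) ≠ 1 := fun h => hx <|
      AddCircle.injective_toCircle one_ne_zero (by ext; simpa using h)
    have hg : ContinuousAt g x.toCircle := by
      have : 1 - (x.toCircle : ℂ) ≠ 0 := sub_ne_zero.2 hx1.symm
      simp only [g]
      fun_prop (disch := assumption)
    refine hg.tendsto.comp ?_
    have := ((Complex.continuous_ofReal.tendsto 1).comp hr).mul_const (x.toCircle : ℂ)
    simpa using this
  have hm := tendstoInMeasure_of_tendsto_ae (fun k => (hcont k).aestronglyMeasurable) hlim
  rw [tendstoInMeasure_iff_measureReal_norm] at hm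
  obtain ⟨k, hk⟩ := ((hm (η / 3) (by positivity)).eventually_lt_const hη).exists
  -- The radius `R = (3 - r)/2` exceeds 1, while `rR < 1` since `(1 - r)(2 - r) > 0`.
  have hd : DifferentiableOn ℂ (fun z => g (r k * z)) (Metric.closedBall 0 ((3 - r k) / 2)) := by
    intro z hz
    have : 1 - (r k : ℂ) * z ≠ 0 := by
      apply hne k
      have := mul_le_mul_of_nonneg_left (mem_closedBall_zero_iff.1 hz) (hr0 k)
      nlinarith [hr1 k, hr0 k, mul_pos (sub_pos.2 (hr1 k)) (by linarith [hr1 k] : 0 < 2 - r k)]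
    apply DifferentiableAt.differentiableWithinAt
    simp only [g]
    fun_prop (disch := assumption)
  obtain ⟨a, n, ha, hn⟩ := exists_polynomial_approx_of_differentiableOn
    (by linarith [hr1 k]) hd (δ := η / 3) (by positivity)
  refine ⟨a, n, by simp [ha, g], lt_of_le_of_lt
    (ENNReal.toReal_mono (measure_ne_top _ _) (measure_mono_ae ?_)) hk⟩
  filter_upwards [ae_ne_zero_haarAddCircle] with x hx hxη
  have hx1 : (x.toCircle : ℂ) ≠ 1 := fun h => hx <|
    AddCircle.injective_toCircle one_ne_zero (by ext; simpa using h)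
  have h1 : η ≤ ‖∑ k ∈ Finset.range n, a k * (x.toCircle : ℂ) ^ k - 1‖ := hxη
  have h2 := hn (x.toCircle : ℂ) (Circle.norm_coe _).le
  have h3 : ‖g x.toCircle - 1‖ = Real.exp (-M) := by
    rw [← norm_exp_mul_two_mul_div_one_sub (Circle.norm_coe x.toCircle) hx1 M, ← norm_neg]
    simp [g]
  have h4 := norm_add₃_le (a := ∑ k ∈ Finset.range n, a k * (x.toCircle : ℂ) ^ k - f k x)
    (b := f k x - g x.toCircle) (c := g x.toCircle - 1)
  simp only [sub_add_sub_cancel] at h4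
  change η / 3 ≤ ‖f k x - g x.toCircle‖
  change ‖_ - f k x‖ < _ at h2
  linarith

/-! ### Integration against complex measures and uniqueness of Fourier coefficients. -/

theorem integral_const_mul_complexMeasure {α : Type*} [MeasurableSpace α]
    (μ : ComplexMeasure α) (c : ℂ) (f : α → ℂ) :
    VectorMeasure.integral μ (fun x => c * f x) (ContinuousLinearMap.mul ℝ ℂ) =
      c * VectorMeasure.integral μ f (ContinuousLinearMap.mul ℝ ℂ) :=
  setToFun_smul (𝕜 := ℂ) _ (fun c s x => by
    exact mul_assoc c x (μ s)) c f

theorem Continuous.integrable_complexMeasure {α : Type*} [MeasurableSpace α] [TopologicalSpace α]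
    [CompactSpace α] [OpensMeasurableSpace α] (μ : ComplexMeasure α) {f : α → ℂ} (hf : Continuous f) :
    VectorMeasure.Integrable μ f :=
  have := isFiniteMeasure_variation_complexMeasure μ
  hf.integrable_of_hasCompactSupport (HasCompactSupport.of_compactSpace _)

theorem norm_integral_complexMeasure_le {α : Type*} [MeasurableSpace α]
    (μ : ComplexMeasure α) {f : α → ℂ} {C : ℝ} (h : ∀ᵐ x ∂μ.variation, ‖f x‖ ≤ C) :
    ‖VectorMeasure.integral μ f (ContinuousLinearMap.mul ℝ ℂ)‖ ≤ C * μ.variation.real Set.univ := by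
  have := isFiniteMeasure_variation_complexMeasure μ
  simpa using VectorMeasure.norm_integral_le_of_norm_le_const (B := ContinuousLinearMap.mul ℝ ℂ) h

theorem ComplexMeasureSupportedOn.ae_mem {μ : ComplexMeasure UnitAddCircle} {K : Set UnitAddCircle}
    (hμ : ComplexMeasureSupportedOn μ K) (hK : MeasurableSet K) : ∀ᵐ x ∂μ.variation, x ∈ K := by
  rw [ae_iff]
  exact (VectorMeasure.variation_apply_eq_zero hK.compl).2 fun t ht htm =>
    hμ t htm (Set.disjoint_left.2 ht)

theorem integral_continuous_eq_zero_of_fourierCoeff_eq_zero {μ : ComplexMeasure UnitAddCircle}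
    (h : ∀ n, complexMeasureFourierCoeff μ n = 0) (f : C(UnitAddCircle, ℂ)) :
    VectorMeasure.integral μ f (ContinuousLinearMap.mul ℝ ℂ) = 0 := by
  let S : Submodule ℂ C(UnitAddCircle, ℂ) :=
    { carrier := {f | VectorMeasure.integral μ f (ContinuousLinearMap.mul ℝ ℂ) = 0}
      zero_mem' := by
        change VectorMeasure.integral μ (fun _ => 0) _ = 0
        exact VectorMeasure.integral_zero
      add_mem' := fun {f g} hf hg => by
        change VectorMeasure.integral μ (f + g : UnitAddCircle → ℂ) _ = 0
        rw [VectorMeasure.integral_add (f.continuous.integrable_complexMeasure μ)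
          (g.continuous.integrable_complexMeasure μ)]
        rw [Set.mem_ofPred_eq] at hf hg
        rw [hf, hg, add_zero]
      smul_mem' := fun c f hf => by
        rw [Set.mem_ofPred_eq] at hf
        exact (integral_const_mul_complexMeasure μ c f).trans (by rw [hf, mul_zero]) }
  have hS : IsClosed (S : Set C(UnitAddCircle, ℂ)) := by
    refine isClosed_of_closure_subset fun f hf => ?_
    change VectorMeasure.integral μ f _ = 0
    rw [← norm_le_zero_iff]
    refine le_of_forall_pos_le_add fun ε hε => ?_
    have hV : 0 < μ.variation.real Set.univ + 1 := by positivity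
    obtain ⟨g, hg, hfg⟩ := Metric.mem_closure_iff.1 hf _ (div_pos hε hV)
    have hg : VectorMeasure.integral μ g (ContinuousLinearMap.mul ℝ ℂ) = 0 := hg
    have h1 := norm_integral_complexMeasure_le μ (f := ⇑f - ⇑g)
      (Eventually.of_forall fun x => ((f - g).norm_coe_le_norm x).trans
        ((dist_eq_norm f g).symm.le.trans hfg.le))
    rw [VectorMeasure.integral_sub (f.continuous.integrable_complexMeasure μ)
      (g.continuous.integrable_complexMeasure μ), hg, sub_zero] at h1
    rw [zero_add]
    refine h1.trans ?_
    rw [div_mul_eq_mul_div, div_le_iff₀ hV]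
    nlinarith
  have hspan : Submodule.span ℂ (Set.range (@fourier 1)) ≤ S := by
    rw [Submodule.span_le]
    rintro _ ⟨n, rfl⟩
    change VectorMeasure.integral μ (fun x => fourier n x) _ = 0
    simpa [complexMeasureFourierCoeff] using h (-n)
  have := Submodule.topologicalClosure_minimal _ hspan hS
  rw [span_fourier_closure_eq_top] at this
  exact this (Submodule.mem_top (x := f))

/-- Trigonometric polynomials are uniformly dense in the continuous functions, which approximate
indicators in `L¹(|μ|)`. -/
theorem complexMeasure_eq_zero_of_fourierCoeff_eq_zero {μ : ComplexMeasure UnitAddCircle}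
    (h : ∀ n, complexMeasureFourierCoeff μ n = 0) : μ = 0 := by
  have := isFiniteMeasure_variation_complexMeasure μ
  ext E hE
  rw [zero_apply, ← norm_le_zero_iff]
  refine le_of_forall_pos_le_add fun ε hε => ?_
  have hint : MeasureTheory.Integrable (E.indicator fun _ => (1 : ℂ)) μ.variation :=
    (integrable_const 1).indicator hE
  obtain ⟨g, -, hg, hgc, hgi⟩ := hint.exists_hasCompactSupport_integral_sub_le hε
  have h0 := integral_continuous_eq_zero_of_fourierCoeff_eq_zero h ⟨g, hgc⟩
  have h1 : VectorMeasure.integral μ (E.indicator fun _ => (1 : ℂ)) (ContinuousLinearMap.mul ℝ ℂ)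
      = μ E := by
    have : IsFiniteMeasure (μ.restrict E).variation :=
      isFiniteMeasure_variation_complexMeasure _
    rw [VectorMeasure.integral_indicator hE, VectorMeasure.integral_const]
    simp [VectorMeasure.restrict_apply, hE]
  have h2 := VectorMeasure.norm_integral_le_integral_norm (μ := μ)
    (B := ContinuousLinearMap.mul ℝ ℂ) (f := (E.indicator fun _ => (1 : ℂ)) - g)
  rw [VectorMeasure.integral_sub hint hgi, h1] at h2
  rw [show VectorMeasure.integral μ g (ContinuousLinearMap.mul ℝ ℂ) = 0 from h0, sub_zero] at h2
  rw [zero_add]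
  exact h2.trans (by simpa using hg)

/-! ### Construction of the set and decay of the coefficients. -/

theorem exists_closed_small_sum_weights {w : ℕ → ℝ}
    (hw0 : Tendsto w atTop (𝓝 0)) (j : ℕ) {η : ℝ} (hη : 0 < η) :
    ∃ (K : Set UnitAddCircle) (a : ℕ → ℂ) (n N : ℕ), IsClosed K ∧ a 0 = 0 ∧ j ≤ N ∧
      (AddCircle.haarAddCircle : Measure UnitAddCircle).real Kᶜ < η ∧
      (∀ x ∈ K, ‖∑ k ∈ Finset.range n, a k * fourier (-((k * N : ℕ) : ℤ)) x - 1‖ ≤ η) ∧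
      (∑ k ∈ Finset.range n, ‖a k‖) * w (N - j) ≤ η := by
  obtain ⟨a, n, ha, hm⟩ := exists_polynomial_near_one_in_measure hη
  set A := ∑ k ∈ Finset.range n, ‖a k‖
  have hlim : Tendsto (fun N => A * w (N - j)) atTop (𝓝 0) := by
    simpa using (hw0.comp (tendsto_sub_atTop_nat j)).const_mul A
  -- Strictness `j < N` makes `N ≠ 0`, so that `x ↦ -N • x` preserves Haar measure.
  obtain ⟨N, hN, hjN⟩ := ((hlim.eventually_lt_const hη).and (eventually_gt_atTop j)).exists
  have hcont : Continuous fun x : UnitAddCircle =>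
      ‖∑ k ∈ Finset.range n, a k * fourier (-((k * N : ℕ) : ℤ)) x - 1‖ := by fun_prop
  refine ⟨{x | ‖∑ k ∈ Finset.range n, a k * fourier (-((k * N : ℕ) : ℤ)) x - 1‖ ≤ η}, a, n, N,
    isClosed_le hcont continuous_const, ha, hjN.le, ?_, fun x hx => hx, hN.le⟩
  have hmp := Measure.measurePreserving_zsmul (AddCircle.haarAddCircle : Measure UnitAddCircle)
    (n := -(N : ℤ)) (by omega)
  refine lt_of_le_of_lt ?_ hm
  have hc : Continuous fun x : UnitAddCircle => (x.toCircle : ℂ) :=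
    continuous_subtype_val.comp AddCircle.continuous_toCircle
  rw [← hmp.measureReal_preimage
    (isClosed_le continuous_const (by fun_prop)).measurableSet.nullMeasurableSet]
  refine measureReal_mono fun x hx => ?_
  have hx : η < ‖∑ k ∈ Finset.range n, a k * fourier (-((k * N : ℕ) : ℤ)) x - 1‖ := not_le.1 hx
  change η ≤ ‖∑ k ∈ Finset.range n, a k * ((-(N : ℤ) • x).toCircle : ℂ) ^ k - 1‖
  have hpow (k : ℕ) : ((-(N : ℤ) • x).toCircle : ℂ) ^ k = fourier (-((k * N : ℕ) : ℤ)) x := by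
    rw [fourier_apply, AddCircle.toCircle_zsmul, AddCircle.toCircle_zsmul, ← Circle.coe_pow,
      ← zpow_natCast, ← zpow_mul]
    congr 2
    push_cast
    ring
  simpa only [hpow] using hx.le

theorem norm_complexMeasureFourierCoeff_le {w : ℕ → ℝ} (hw : Antitone w)
    {K : Set UnitAddCircle} {a : ℕ → ℂ} {n N j : ℕ} {η C : ℝ} {μ : ComplexMeasure UnitAddCircle}
    (hC : 0 ≤ C) (hμC : ∀ n : ℕ, ‖complexMeasureFourierCoeff μ n‖ ≤ C * w n)
    (hμK : ∀ᵐ x ∂μ.variation, x ∈ K) (ha : a 0 = 0) (hjN : j ≤ N)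
    (hK : ∀ x ∈ K, ‖∑ k ∈ Finset.range n, a k * fourier (-((k * N : ℕ) : ℤ)) x - 1‖ ≤ η)
    (hsum : (∑ k ∈ Finset.range n, ‖a k‖) * w (N - j) ≤ η) {l : ℤ} (hl : l.natAbs ≤ j) :
    ‖complexMeasureFourierCoeff μ l‖ ≤ η * (C + μ.variation.real Set.univ) := by
  set I := fun f : UnitAddCircle → ℂ => VectorMeasure.integral μ f (ContinuousLinearMap.mul ℝ ℂ)
  have h1 : I (fun x => ∑ k ∈ Finset.range n, a k * fourier (-(l + (k * N : ℕ))) x) =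
      ∑ k ∈ Finset.range n, a k * complexMeasureFourierCoeff μ (l + (k * N : ℕ)) := by
    simp only [I]
    rw [VectorMeasure.integral_finsetSum _ fun k _ =>
      Continuous.integrable_complexMeasure μ (by fun_prop)]
    exact Finset.sum_congr rfl fun k _ => integral_const_mul_complexMeasure μ _ _
  have h2 : ‖I (fun x => ∑ k ∈ Finset.range n, a k * fourier (-(l + (k * N : ℕ))) x)‖ ≤
      C * η := by
    rw [h1]
    calc _ ≤ ∑ k ∈ Finset.range n, ‖a k‖ * (C * w (N - j)) := by
          refine norm_sum_le_of_le _ fun k _ => ?_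
          rw [norm_mul]
          rcases Nat.eq_zero_or_pos k with rfl | hk
          · simp [ha]
          refine mul_le_mul_of_nonneg_left ?_ (norm_nonneg _)
          -- For `k ≥ 1` and `|l| ≤ j ≤ N`, the index `l + kN` is at least `N - j ≥ 0`, where the
          -- hypothesis on `μ` applies.
          have hkN : N ≤ k * N := Nat.le_mul_of_pos_left _ hk
          obtain ⟨m, hm⟩ := Int.eq_ofNat_of_zero_le (a := l + (k * N : ℕ)) (by omega)
          rw [hm]
          exact (hμC m).trans (mul_le_mul_of_nonneg_left (hw (by omega)) hC)
      _ = C * ((∑ k ∈ Finset.range n, ‖a k‖) * w (N - j)) := by rw [← Finset.sum_mul]; ring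
      _ ≤ C * η := mul_le_mul_of_nonneg_left hsum hC
  have h3 : ‖I ((fun x => ∑ k ∈ Finset.range n, a k * fourier (-(l + (k * N : ℕ))) x) -
      fun x => fourier (-l) x)‖ ≤ η * μ.variation.real Set.univ := by
    refine norm_integral_complexMeasure_le μ ?_
    filter_upwards [hμK] with x hx
    refine le_of_eq_of_le ?_ (hK x hx)
    have : ∑ k ∈ Finset.range n, a k * fourier (-(l + (k * N : ℕ))) x - fourier (-l) x =
        fourier (-l) x *
          (∑ k ∈ Finset.range n, a k * fourier (-((k * N : ℕ) : ℤ)) x - 1) := by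
      rw [mul_sub, mul_one, Finset.mul_sum]
      congr 1
      refine Finset.sum_congr rfl fun k _ => ?_
      rw [neg_add, fourier_add]
      ring
    rw [Pi.sub_apply, this, norm_mul, fourier_apply (n := -l), Circle.norm_coe, one_mul]
  simp only [I] at h2 h3
  rw [VectorMeasure.integral_sub (Continuous.integrable_complexMeasure μ (by fun_prop))
    (Continuous.integrable_complexMeasure μ (by fun_prop))] at h3
  have h4 := norm_sub_le_norm_sub_add_norm_sub
    (complexMeasureFourierCoeff μ l)
    (I (fun x => ∑ k ∈ Finset.range n, a k * fourier (-(l + (k * N : ℕ))) x)) 0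
  rw [sub_zero, sub_zero, norm_sub_rev] at h4
  refine h4.trans ((add_le_add h3 h2).trans (by linarith))

theorem norm_le_toReal_mul_of_iSup_enorm_div_lt_top {u : ℕ → ℂ} {w : ℕ → ℝ} (hw : ∀ n, 0 ≤ w n)
    (h : (⨆ n : ℕ, ‖u n‖ₑ / ENNReal.ofReal (w n)) < ⊤) (n : ℕ) :
    ‖u n‖ ≤ (⨆ n : ℕ, ‖u n‖ₑ / ENNReal.ofReal (w n)).toReal * w n := by
  set S := ⨆ n : ℕ, ‖u n‖ₑ / ENNReal.ofReal (w n)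
  have h1 : ‖u n‖ₑ / ENNReal.ofReal (w n) ≤ S := le_iSup (fun n => ‖u n‖ₑ / ENNReal.ofReal (w n)) n
  have h2 : ‖u n‖ₑ ≤ S * ENNReal.ofReal (w n) := by
    rcases eq_or_ne (ENNReal.ofReal (w n)) 0 with h0 | h0
    · rw [h0] at h1 ⊢
      rcases eq_or_ne ‖u n‖ₑ 0 with hu | hu
      · simp [hu]
      · rw [ENNReal.div_zero hu] at h1
        exact absurd h (not_lt.2 h1)
    · exact (ENNReal.div_le_iff h0 ENNReal.ofReal_ne_top).1 h1
  have h3 := ENNReal.toReal_mono (ENNReal.mul_ne_top h.ne ENNReal.ofReal_ne_top) h2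
  rwa [ENNReal.toReal_mul, ENNReal.toReal_ofReal (hw n), toReal_enorm] at h3

theorem mainTheorem7 (w : ℕ → ℝ) (hw : Antitone w)
    (hw0 : Filter.Tendsto w Filter.atTop (nhds 0)) (ε : ℝ) (hε : 0 < ε) :
    ∃ K : Set UnitAddCircle, IsCompact K ∧
      1 - ε < (AddCircle.haarAddCircle : MeasureTheory.Measure UnitAddCircle).real K ∧
      ∀ μ : MeasureTheory.ComplexMeasure UnitAddCircle,
        ComplexMeasureSupportedOn μ K →
        (⨆ n : ℕ, ‖complexMeasureFourierCoeff μ (n : ℤ)‖ₑ / ENNReal.ofReal (w n)) < ⊤ →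
        μ = 0 := by
  -- The total is `ε/2 < ε`, and `η j → 0` kills each fixed coefficient.
  let η : ℕ → ℝ := fun j => ε / 4 * (1 / 2) ^ j
  have hη (j) : 0 < η j := by positivity
  have hηsum : HasSum η (ε / 4 * 2) := hasSum_geometric_two.mul_left _
  choose K a n N hKc ha hjN hKm hK hsum using
    fun j => exists_closed_small_sum_weights hw0 j (hη j)
  have hKI : IsClosed (⋂ j, K j) := isClosed_iInter hKc
  refine ⟨⋂ j, K j, hKI.isCompact, ?_, fun μ hμ hfin => ?_⟩
  · have h1 : (AddCircle.haarAddCircle : Measure UnitAddCircle).real (⋂ j, K j)ᶜ ≤ ε / 4 * 2 := by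
      rw [Set.compl_iInter]
      refine ENNReal.toReal_le_of_le_ofReal (by positivity) ((measure_iUnion_le _).trans ?_)
      rw [← hηsum.tsum_eq, ENNReal.ofReal_tsum_of_nonneg (fun j => (hη j).le) hηsum.summable]
      refine ENNReal.tsum_le_tsum fun j => ?_
      rw [← ofReal_measureReal]
      exact ENNReal.ofReal_le_ofReal (hKm j).le
    rw [probReal_compl_eq_one_sub hKI.measurableSet] at h1
    linarith
  · refine complexMeasure_eq_zero_of_fourierCoeff_eq_zero fun l => ?_
    have hC := norm_le_toReal_mul_of_iSup_enorm_div_lt_top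
      (fun n => hw.le_of_tendsto hw0 n) hfin
    set C := (⨆ n : ℕ, ‖complexMeasureFourierCoeff μ (n : ℤ)‖ₑ / ENNReal.ofReal (w n)).toReal
    have hae := hμ.ae_mem hKI.measurableSet
    have hlim : Tendsto (fun j => η j * (C + μ.variation.real Set.univ)) atTop (𝓝 0) := by
      simpa using hηsum.summable.tendsto_atTop_zero.mul_const (C + μ.variation.real Set.univ)
    rw [← norm_le_zero_iff]
    refine ge_of_tendsto hlim ((eventually_ge_atTop l.natAbs).mono fun j hj => ?_)
    exact norm_complexMeasureFourierCoeff_le hw ENNReal.toReal_nonneg hC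
      (hae.mono fun x hx => Set.mem_iInter.1 hx j) (ha j) (hjN j) (hK j) (hsum j) hj
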